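/- **Setting.** Let $W$ be a nondeterministic recursive probabilistic program over integer variables, given by its control-flow graph: a finite set $F$ of function names, a finite set $V_{\mathrm r}$ of sampling variables and, for each $\mathsf f\in F$, a finite set $L_{\mathsf f}$ of labels, a finite set $V_{\mathsf f}$ of program variables, an initial label $\ell_{\rm in}^{\mathsf f}$ and a terminal label $\ell_{\rm out}^{\mathsf f}\neq \ell_{\rm in}^{\mathsf f}$. Write $\mathrm{Val}_V=\mathbb Z^{V}$. Every label $\ell\in L_{\mathsf f}\setminus\{\ell^{\mathsf f}_{\rm out}\}$ is exactly one of the following: an *assignment* label with an update function $u:\mathrm{Val}_{V_{\mathsf f}}\times \mathrm{Val}_{V_{\mathrm r}}\to \mathrm{Val}_{V_{\mathsf f}}$ and a successor $\ell'$; a *call* label with a callee $\mathsf g\in F$, a value-passing function $v:\mathrm{Val}_{V_{\mathsf f}}\to \mathrm{Val}_{V_{\mathsf g}}$ and a successor $\ell'$; a *branching* label with a propositional arithmetic predicate $\phi$ over $V_{\mathsf f}$ and successors $\ell_1$ (if $\phi$ holds) and $\ell_2$ (if it does not); a *nondeterministic* label with a then-successor $\ell_1$ and an else-successor $\ell_2$.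 A sampling function $\Upsilon$ assigns to each $r\in V_{\mathrm r}$ a probability distribution on $\mathbb Z$; put $\overline\Upsilon(\mu)=\prod_{r}\Upsilon(r)(\mu(r))$ for $\mu\in\mathrm{Val}_{V_{\mathrm r}}$. A *stack element* is a triple $(\mathsf f,\ell,\nu)$ with $\mathsf f\in F$, $\ell\in L_{\mathsf f}$, $\nu\in\mathrm{Val}_{V_{\mathsf f}}$; it is *terminal* if $\ell=\ell_{\rm out}^{\mathsf f}$. A *configuration* is a finite word of non-terminal stack elements (the first letter is the top of the call stack; $\varepsilon$ is the empty word). The semantics is a Markov decision process with states $(w,\mu)$, $w$ a configuration and $\mu\in \mathrm{Val}_{V_{\mathrm r}}$, and actions $\tau,\mathbf{th},\mathbf{el}$. In every step a valuation $\mu'$ is drawn from $\overline\Upsilon$ and becomes the second component of the next state. The configuration $\varepsilon$ stays $\varepsilon$. If the configuration is $(\mathsf f,\ell,\nu)\cdot w$, its first letter is replaced by $(\mathsf f,\ell',u(\nu,\mu'))$ (assignment, action $\tau$), by $(\mathsf g,\ell_{\rm in}^{\mathsf g},v(\nu))\cdot(\mathsf f,\ell',\nu)$ (call, action $\tau$),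 by $(\mathsf f,\ell_1,\nu)$ if $\nu\models\phi$ and by $(\mathsf f,\ell_2,\nu)$ otherwise (branching, action $\tau$), by $(\mathsf f,\ell_1,\nu)$ under $\mathbf{th}$ or $(\mathsf f,\ell_2,\nu)$ under $\mathbf{el}$ (nondeterministic); terminal stack elements that arise are deleted from the word. All other transition probabilities are $0$, and an action is *enabled* at a state if its transition probabilities there sum to $1$. A *history* is a nonempty finite word of states in which every step has positive probability under some action. A *scheduler* $\sigma$ maps every history $\rho$ to a probability distribution on the actions enabled at the last state of $\rho$. For a non-terminal stack element $\mathfrak c$, $\mathbb P^\sigma_{\mathfrak c}$ is the induced probability measure on infinite runs that start in the state $(\mathfrak c,\mathbf 0)$ (one-letter configuration, all-zero valuation), and $T\in\mathbb N_0\cup\{\infty\}$ is the first time at which the configuration is $\varepsilon$. **Ranking measure functions.** Let $\mathcal E$ be the set of stack elements. A function $h:\mathcal E\to[0,\infty]$ is a *ranking measure function* with constant $\epsilon\in(0,\infty)$ if $h$ is $0$ at all terminal stack elements and, for every non-terminal $(\mathsf f,\ell,\nu)$ (with $0\cdot\infty=0$): * assignment: $\epsilon+\sum_{\mu:\overline\Upsilon(\mu)>0}\overline\Upsilon(\mu)\,h(\mathsf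 f,\ell',u(\nu,\mu))\le h(\mathsf f,\ell,\nu)$; * call: $\epsilon+h(\mathsf g,\ell_{\rm in}^{\mathsf g},v(\nu))+h(\mathsf f,\ell',\nu)\le h(\mathsf f,\ell,\nu)$; * branching: $\mathbf 1_{\nu\models\phi}\,h(\mathsf f,\ell_1,\nu)+\mathbf 1_{\nu\models\neg\phi}\,h(\mathsf f,\ell_2,\nu)+\epsilon\le h(\mathsf f,\ell,\nu)$; * nondeterministic: $\max\{h(\mathsf f,\ell_1,\nu),h(\mathsf f,\ell_2,\nu)\}+\epsilon\le h(\mathsf f,\ell,\nu)$. It is *difference-bounded* with constant $\zeta\in(0,\infty)$ if moreover, for every non-terminal $(\mathsf f,\ell,\nu)$ with $h(\mathsf f,\ell,\nu)<\infty$: * assignment: $|h(\mathsf f,\ell',u(\nu,\mu))-h(\mathsf f,\ell,\nu)|\le\zeta$ for all $\mu$ with $\overline\Upsilon(\mu)>0$; * call: $|h(\mathsf g,\ell_{\rm in}^{\mathsf g},v(\nu))+h(\mathsf f,\ell',\nu)-h(\mathsf f,\ell,\nu)|\le\zeta$; * branching: $|\mathbf 1_{\nu\models\phi}h(\mathsf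 f,\ell_1,\nu)+\mathbf 1_{\nu\models\neg\phi}h(\mathsf f,\ell_2,\nu)-h(\mathsf f,\ell,\nu)|\le\zeta$; * nondeterministic: $\max_{i\in\{1,2\}}|h(\mathsf f,\ell_i,\nu)-h(\mathsf f,\ell,\nu)|\le\zeta$. **Theorem.** Let $h$ be a difference-bounded ranking measure function with constants $\epsilon,\zeta$. Then for every non-terminal stack element $\mathfrak c$ with $h(\mathfrak c)<\infty$ and every $n\in\mathbb N_0$ with $n>h(\mathfrak c)/\epsilon$, $$\sup_\sigma\mathbb P^\sigma_{\mathfrak c}(T>n)\le \exp\left(-\frac{(\epsilon n-h(\mathfrak c))^2}{2n(\epsilon+\zeta)^2}\right),$$ where $\sigma$ ranges over all schedulers. -/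

import Mathlib

open scoped ENNReal NNReal
open MeasureTheory ProbabilityTheory

noncomputable section

namespace RecProg

/-! ### Valuations, arithmetic expressions and predicates -/

/-- A valuation over a set `V` of variables assigns an integer to every variable. -/
abbrev Valuation (V : Type) : Type := V → ℤ

/-- No syntax is fixed for arithmetic expressions; an expression over `V` is represented by its
(total, integer-valued) evaluation map. -/
abbrev ArithExpr (V : Type) : Type := Valuation V → ℤ

/-- Propositional arithmetic predicates over `V`. -/
inductive ArithPred (V : Type) : Type
  | lt (e e' : ArithExpr V)
  | le (e e' : ArithExpr V)
  | gt (e e' : ArithExpr V)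
  | ge (e e' : ArithExpr V)
  | or (φ ψ : ArithPred V)
  | and (φ ψ : ArithPred V)
  | not (φ : ArithPred V)

/-- The satisfaction relation between valuations and predicates. -/
def ArithPred.Sat {V : Type} (ν : Valuation V) : ArithPred V → Prop
  | .lt e e' => e ν < e' ν
  | .le e e' => e ν ≤ e' ν
  | .gt e e' => e ν > e' ν
  | .ge e e' => e ν ≥ e' ν
  | .or φ ψ => φ.Sat ν ∨ ψ.Sat ν
  | .and φ ψ => φ.Sat ν ∧ ψ.Sat ν
  | .not φ => ¬ φ.Sat ν

/-! ### Control-flow graphs -/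

/-- The transitions leaving one label of the function `f`, by the type of that label:
* `assign u ℓ'`: an assignment label, whose only triple is `(ℓ, u, ℓ')`;
* `call g v ℓ'`: a call label, whose only triple is `(ℓ, (g, v), ℓ')`;
* `branch φ ℓ₁ ℓ₂`: a branching label, whose triples are `(ℓ, φ, ℓ₁)` and `(ℓ, ¬φ, ℓ₂)`;
* `nondet ℓ₁ ℓ₂`: a nondeterministic label, whose triples are `(ℓ, ⋆, ℓ₁)` (then-branch) and
  `(ℓ, ⋆, ℓ₂)` (else-branch). -/
inductive Instr {Fn : Type} (SVar : Type) (Label PVar : Fn → Type) (f : Fn) : Type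
  | assign (u : Valuation (PVar f) → Valuation SVar → Valuation (PVar f)) (next : Label f)
  | call (g : Fn) (v : Valuation (PVar f) → Valuation (PVar g)) (next : Label f)
  | branch (φ : ArithPred (PVar f)) (thn els : Label f)
  | nondet (thn els : Label f)

/-- The control-flow graph of a nondeterministic recursive probabilistic program. -/
structure CFG where
  /-- function names -/
  Fn : Type
  /-- sampling variables -/
  SVar : Type
  /-- labels attached to a function name -/
  Label : Fn → Type
  /-- program variables attached to a function name -/
  PVar : Fn → Type
  [fintypeFn : Fintype Fn]
  [fintypeSVar : Fintype SVar]
  [fintypeLabel : ∀ f, Fintype (Label f)]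
  [fintypePVar : ∀ f, Fintype (PVar f)]
  /-- initial label -/
  lin : ∀ f, Label f
  /-- terminal label -/
  lout : ∀ f, Label f
  /-- A function body contains at least one statement, so its initial label is not terminal. -/
  lin_ne_lout : ∀ f, lin f ≠ lout f
  /-- the transitions leaving a non-terminal label -/
  instr : ∀ (f : Fn) (ℓ : Label f), ℓ ≠ lout f → Instr SVar Label PVar f

attribute [instance] CFG.fintypeFn CFG.fintypeSVar CFG.fintypeLabel CFG.fintypePVar

/-- Stack elements `(f, ℓ, ν)`. -/
structure StackElem (W : CFG) where
  fn : W.Fn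
  label : W.Label fn
  val : Valuation (W.PVar fn)

/-- A stack element is terminal if its label is the terminal label of its function. -/
def StackElem.Terminal {W : CFG} (c : StackElem W) : Prop := c.label = W.lout c.fn

/-- Configurations: finite words of non-terminal stack elements. The first letter is the top of the
call stack. -/
abbrev Config (W : CFG) : Type := List {c : StackElem W // ¬ c.Terminal}

/-! ### Sampling functions -/

/-- A sampling function assigns to every sampling variable a discrete distribution over `ℤ`. -/
abbrev SamplingFn (W : CFG) : Type := W.SVar → PMF ℤ

/-- The product distribution over valuations of the sampling variables, as a function. -/
def SamplingFn.prod {W : CFG} (Υ : SamplingFn W) (μ : Valuation W.SVar) : ℝ≥0∞ :=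
  ∏ r, Υ r (μ r)

/-! ### The Markov decision process of a program -/

/-- Actions. -/
inductive Act : Type
  | tau
  | th
  | el

/-- States of the MDP: the current configuration and the sampling of the previous step. -/
abbrev State (W : CFG) : Type := Config W × Valuation W.SVar

open Classical in
/-- The configuration after control in function `f` moves to label `ℓ` with valuation `ν`, where `w`
is the rest of the call stack: the stack element is dropped if `ℓ` is terminal. -/
def goto {W : CFG} (f : W.Fn) (ℓ : W.Label f) (ν : Valuation (W.PVar f)) (w : Config W) :
    Config W :=
  if h : ℓ = W.lout f then w else ⟨⟨f, ℓ, ν⟩, h⟩ :: w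

open Classical in
/-- The next configuration under action `a` when the current configuration is `c :: w` and the
sampled values are `μ'`; `none` if `a` does not fit the type of the label of `c`. -/
def nextConfig {W : CFG} (c : {c : StackElem W // ¬ c.Terminal}) (w : Config W) (a : Act)
    (μ' : Valuation W.SVar) : Option (Config W) :=
  match W.instr c.1.fn c.1.label c.2, a with
  | .assign u ℓ', .tau => some (goto c.1.fn ℓ' (u c.1.val μ') w)
  | .call g v ℓ', .tau =>
      some (⟨⟨g, W.lin g, v c.1.val⟩, W.lin_ne_lout g⟩ :: goto c.1.fn ℓ' c.1.val w)
  | .branch φ ℓ₁ ℓ₂, .tau => some (goto c.1.fn (if φ.Sat c.1.val then ℓ₁ else ℓ₂) c.1.val w)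
  | .nondet ℓ₁ _, .th => some (goto c.1.fn ℓ₁ c.1.val w)
  | .nondet _ ℓ₂, .el => some (goto c.1.fn ℓ₂ c.1.val w)
  | _, _ => none

open Classical in
/-- The probability transition function of the MDP. -/
def transProb {W : CFG} (Υ : SamplingFn W) : State W → Act → State W → ℝ≥0∞
  | ([], _), _, (w', μ') => if w' = [] then Υ.prod μ' else 0
  | (c :: w, _), a, (w', μ') => if nextConfig c w a μ' = some w' then Υ.prod μ' else 0

/-- An action is enabled at a state if its transition probabilities sum up to one. -/
def Enabled {W : CFG} (Υ : SamplingFn W) (s : State W) (a : Act) : Prop :=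
  ∑' s', transProb Υ s a s' = 1

/-- A history is a nonempty finite word of states in which every step has positive probability under
some action. -/
structure History {W : CFG} (Υ : SamplingFn W) where
  states : List (State W)
  ne_nil : states ≠ []
  chain : states.IsChain fun s s' => ∃ a, 0 < transProb Υ s a s'

/-- The last state of a history. -/
def History.last {W : CFG} {Υ : SamplingFn W} (ρ : History Υ) : State W :=
  ρ.states.getLast ρ.ne_nil

/-- The one-state history `s`. -/
def History.single {W : CFG} (Υ : SamplingFn W) (s : State W) : History Υ :=
  ⟨[s], by simp, by simp⟩

/-- The history `ρ · s`. -/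
def History.snoc {W : CFG} {Υ : SamplingFn W} (ρ : History Υ) (s : State W)
    (h : ∃ a, 0 < transProb Υ ρ.last a s) : History Υ where
  states := ρ.states ++ [s]
  ne_nil := by simp
  chain := by
    refine ρ.chain.append (by simp) ?_
    intro x hx y hy
    rw [List.getLast?_eq_getLast_of_ne_nil ρ.ne_nil] at hx
    simp only [Option.mem_def, Option.some.injEq, List.head?_cons] at hx hy
    subst hx; subst hy
    exact h

/-- A scheduler maps every history to a discrete distribution over the actions enabled at its last
state. -/
def Scheduler {W : CFG} (Υ : SamplingFn W) : Type :=
  ∀ ρ : History Υ, PMF {a : Act // Enabled Υ ρ.last a}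

/-! ### The Markov chain induced by a scheduler -/

/-- The distribution of the next state after the history `ρ`: the state `s` has probability
`∑ a, σ(ρ)(a) * P(last ρ, a, s)`. -/
def nextState {W : CFG} {Υ : SamplingFn W} (σ : Scheduler Υ) (ρ : History Υ) : PMF (State W) :=
  (σ ρ).bind fun a => ⟨transProb Υ ρ.last a.1, ENNReal.summable.hasSum_iff.2 a.2⟩

theorem exists_transProb_pos {W : CFG} {Υ : SamplingFn W} (σ : Scheduler Υ) (ρ : History Υ)
    (s : State W) (hs : s ∈ (nextState σ ρ).support) : ∃ a, 0 < transProb Υ ρ.last a s := by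
  obtain ⟨a, -, ha⟩ := (PMF.mem_support_bind_iff _ _ _).1 hs
  exact ⟨a.1, pos_iff_ne_zero.2 ((PMF.mem_support_iff _ _).1 ha)⟩

/-- The transition probabilities of the Markov chain on histories: `ρ` moves to `ρ · s`, where `s`
is drawn from `nextState σ ρ`. -/
def nextHistory {W : CFG} {Υ : SamplingFn W} (σ : Scheduler Υ) (ρ : History Υ) :
    PMF (History Υ) :=
  (nextState σ ρ).bindOnSupport fun s hs => PMF.pure (ρ.snoc s (exists_transProb_pos σ ρ s hs))

instance {W : CFG} (Υ : SamplingFn W) : MeasurableSpace (History Υ) := ⊤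

instance {W : CFG} (Υ : SamplingFn W) : DiscreteMeasurableSpace (History Υ) := ⟨fun _ => trivial⟩

/-- The transition kernel of the Markov chain on histories. -/
def stepKernel {W : CFG} {Υ : SamplingFn W} (σ : Scheduler Υ) :
    Kernel (History Υ) (History Υ) where
  toFun ρ := (nextHistory σ ρ).toMeasure
  measurable' := Measurable.of_discrete

instance {W : CFG} {Υ : SamplingFn W} (σ : Scheduler Υ) : IsMarkovKernel (stepKernel σ) :=
  ⟨fun ρ => PMF.toMeasure.isProbabilityMeasure (nextHistory σ ρ)⟩

/-- The probability measure on infinite sequences of histories (with the product `σ`-algebra,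
generated by the cylinders) of the Markov chain induced by `σ`, started from the one-letter
configuration `c` together with the all-zero valuation of the sampling variables. It is carried by
the infinite runs, in which every history extends the preceding one by one state. -/
def runMeasure {W : CFG} {Υ : SamplingFn W} (σ : Scheduler Υ) (c : StackElem W)
    (hc : ¬ c.Terminal) : Measure (ℕ → History Υ) :=
  Kernel.trajMeasure (X := fun _ => History Υ)
    (Measure.dirac (History.single Υ ([⟨c, hc⟩], 0)))
    (fun n => (stepKernel σ).comap
      (fun ω : (i : Finset.Iic n) → History Υ => ω ⟨n, Finset.mem_Iic.2 le_rfl⟩)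
      (measurable_pi_apply _))

/-- The termination time of a run: the first time at which the configuration is empty, and `∞` if
there is no such time. -/
def terminationTime {W : CFG} {Υ : SamplingFn W} (ω : ℕ → History Υ) : ℕ∞ :=
  ⨅ (n : ℕ) (_ : (ω n).last.1 = []), (n : ℕ∞)

/-! ### Ranking measure functions -/

open Classical in
/-- `h` is a ranking measure function with constant `ε`. In the assignment case, the sum over all
valuations is the sum over the support of the sampling distribution, as `0 * ∞ = 0`. -/
def IsRankingWith {W : CFG} (Υ : SamplingFn W) (h : StackElem W → ℝ≥0∞) (ε : ℝ≥0) : Prop :=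
  (∀ c : StackElem W, c.Terminal → h c = 0) ∧
  ∀ (f : W.Fn) (ℓ : W.Label f) (hℓ : ℓ ≠ W.lout f) (ν : Valuation (W.PVar f)),
    match W.instr f ℓ hℓ with
    | .assign u ℓ' => (ε : ℝ≥0∞) + ∑' μ, Υ.prod μ * h ⟨f, ℓ', u ν μ⟩ ≤ h ⟨f, ℓ, ν⟩
    | .call g v ℓ' => (ε : ℝ≥0∞) + h ⟨g, W.lin g, v ν⟩ + h ⟨f, ℓ', ν⟩ ≤ h ⟨f, ℓ, ν⟩
    | .branch φ ℓ₁ ℓ₂ =>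
        (if φ.Sat ν then h ⟨f, ℓ₁, ν⟩ else 0) + (if φ.not.Sat ν then h ⟨f, ℓ₂, ν⟩ else 0) + ε
          ≤ h ⟨f, ℓ, ν⟩
    | .nondet ℓ₁ ℓ₂ => max (h ⟨f, ℓ₁, ν⟩) (h ⟨f, ℓ₂, ν⟩) + ε ≤ h ⟨f, ℓ, ν⟩

/-- The absolute difference `|a - b|` of two elements of `[0, ∞]` that are not both `∞` (one of the
two truncated differences is zero). -/
def absDiff (a b : ℝ≥0∞) : ℝ≥0∞ := max (a - b) (b - a)

open Classical in
/-- The stepwise absolute differences of `h` are bounded by `ζ` wherever `h` is finite. -/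
def IsDiffBoundedWith {W : CFG} (Υ : SamplingFn W) (h : StackElem W → ℝ≥0∞) (ζ : ℝ≥0) : Prop :=
  ∀ (f : W.Fn) (ℓ : W.Label f) (hℓ : ℓ ≠ W.lout f) (ν : Valuation (W.PVar f)),
    h ⟨f, ℓ, ν⟩ < ∞ →
    match W.instr f ℓ hℓ with
    | .assign u ℓ' => ∀ μ, 0 < Υ.prod μ → absDiff (h ⟨f, ℓ', u ν μ⟩) (h ⟨f, ℓ, ν⟩) ≤ ζ
    | .call g v ℓ' => absDiff (h ⟨g, W.lin g, v ν⟩ + h ⟨f, ℓ', ν⟩) (h ⟨f, ℓ, ν⟩) ≤ ζ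
    | .branch φ ℓ₁ ℓ₂ =>
        absDiff ((if φ.Sat ν then h ⟨f, ℓ₁, ν⟩ else 0) +
          (if φ.not.Sat ν then h ⟨f, ℓ₂, ν⟩ else 0)) (h ⟨f, ℓ, ν⟩) ≤ ζ
    | .nondet ℓ₁ ℓ₂ =>
        max (absDiff (h ⟨f, ℓ₁, ν⟩) (h ⟨f, ℓ, ν⟩)) (absDiff (h ⟨f, ℓ₂, ν⟩) (h ⟨f, ℓ, ν⟩)) ≤ ζ

end RecProg

end

/-! This is Azuma–Hoeffding applied to an exponential potential. Let H be the sum of h over the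
letters of the call stack (`configSum`). A step rewrites only the top letter, so the ranking and
difference conditions pass to H: until termination H drops by at least ε on average and moves by at
most ζ. Hence Z = H' - H + ε has mean at most 0 and |Z| ≤ ε + ζ, and for t ≥ 0 Hoeffding's estimate
(`tsum_mul_expENN_le`) shows that each step multiplies the expectation of exp(tH) by at most exp(-tε
+ t²(ε+ζ)²/2).

The drift stops at the empty stack, so `potential` is set to 0 there. The one-step bound then holds
at every state and for every enabled action, hence under every scheduler, and it iterates along the
run. On T > n the potential is at least 1, so Markov's inequality bounds the tail by the n-th power
of the factor times exp(t h(c)). The theorem is the optimal choice of t.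

All expectations are taken in [0, ∞], so no integrability question arises. -/

namespace RecProg

/-! ### The Hoeffding estimate for extended nonnegative random variables -/

/-- The exponential `exp (t * x)` of an extended nonnegative number, with value `∞` at `∞`. -/
noncomputable def expENN (t : ℝ) (x : ℝ≥0∞) : ℝ≥0∞ :=
  if x = ∞ then ∞ else ENNReal.ofReal (Real.exp (t * x.toReal))

theorem expENN_top (t : ℝ) : expENN t ∞ = ∞ := if_pos rfl

theorem expENN_of_ne_top (t : ℝ) {x : ℝ≥0∞} (hx : x ≠ ∞) :
    expENN t x = ENNReal.ofReal (Real.exp (t * x.toReal)) := if_neg hx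

theorem one_le_expENN {t : ℝ} (ht : 0 ≤ t) (x : ℝ≥0∞) : 1 ≤ expENN t x := by
  by_cases hx : x = ∞
  · simp [hx, expENN_top]
  · rw [expENN_of_ne_top t hx, ENNReal.one_le_ofReal]
    exact Real.one_le_exp (by positivity)

/-- Convexity: on `[-c, c]` the exponential lies below its chord. -/
theorem exp_mul_le_cosh_add (t : ℝ) {c z : ℝ} (hc : 0 < c) (hz : |z| ≤ c) :
    Real.exp (t * z) ≤ Real.cosh (t * c) + z * (Real.sinh (t * c) / c) := by
  obtain ⟨h1, h2⟩ := abs_le.1 hz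
  have key := convexOn_exp.2 (Set.mem_univ (t * c)) (Set.mem_univ (-(t * c)))
    (show 0 ≤ (c + z) / (2 * c) from div_nonneg (by linarith) (by linarith))
    (show 0 ≤ (c - z) / (2 * c) from div_nonneg (by linarith) (by linarith))
    (by field_simp; ring)
  have e : ((c + z) / (2 * c)) • (t * c) + ((c - z) / (2 * c)) • (-(t * c)) = t * z := by
    simp only [smul_eq_mul]; field_simp; ring
  rw [e] at key
  refine key.trans (le_of_eq ?_)
  rw [Real.cosh_eq, Real.sinh_eq]
  simp only [smul_eq_mul]
  field_simp
  ring

/-- The chord bound at z = x - y + ε, with the negative term moved to the left: free of subtraction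
in [0, ∞], it can be averaged over x term by term. -/
theorem expENN_mul_add_le {t ε ζ : ℝ} (ht : 0 ≤ t) (hε : 0 < ε) (hζ : 0 ≤ ζ) {x y : ℝ≥0∞}
    (hy : y ≠ ∞) (hxy : absDiff x y ≤ ENNReal.ofReal ζ) :
    expENN t x * ENNReal.ofReal (Real.exp (t * (ε - y.toReal))) +
        y * ENNReal.ofReal (Real.sinh (t * (ε + ζ)) / (ε + ζ)) ≤
      ENNReal.ofReal (Real.cosh (t * (ε + ζ)) + ε * (Real.sinh (t * (ε + ζ)) / (ε + ζ))) +
        ENNReal.ofReal (Real.sinh (t * (ε + ζ)) / (ε + ζ)) * x := by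
  have hc : 0 < ε + ζ := by linarith
  have hβ : 0 ≤ Real.sinh (t * (ε + ζ)) / (ε + ζ) :=
    div_nonneg (Real.sinh_nonneg_iff.2 (by positivity)) hc.le
  have hch := (Real.cosh_pos (t * (ε + ζ))).le
  obtain ⟨h1, h2⟩ := max_le_iff.1 hxy
  have hx : x ≠ ∞ := by
    rintro rfl
    rw [ENNReal.top_sub hy] at h1
    exact ENNReal.ofReal_ne_top (top_le_iff.1 h1)
  rw [expENN_of_ne_top t hx]
  lift x to ℝ≥0 using hx
  lift y to ℝ≥0 using hy
  rw [tsub_le_iff_right, ← ENNReal.ofReal_coe_nnreal, ← ENNReal.ofReal_coe_nnreal (p := y),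
    ← ENNReal.ofReal_add hζ y.coe_nonneg, ENNReal.ofReal_le_ofReal_iff (by positivity)] at h1
  rw [tsub_le_iff_right, ← ENNReal.ofReal_coe_nnreal, ← ENNReal.ofReal_coe_nnreal (p := x),
    ← ENNReal.ofReal_add hζ x.coe_nonneg, ENNReal.ofReal_le_ofReal_iff (by positivity)] at h2
  rw [← ENNReal.ofReal_mul (Real.exp_pos _).le, ← ENNReal.ofReal_coe_nnreal (p := y),
    ← ENNReal.ofReal_coe_nnreal (p := x), ← ENNReal.ofReal_mul y.coe_nonneg, ← ENNReal.ofReal_mul hβ,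
    ← ENNReal.ofReal_add (by positivity) (by positivity),
    ← ENNReal.ofReal_add (by positivity) (by positivity)]
  refine ENNReal.ofReal_le_ofReal ?_
  have key := exp_mul_le_cosh_add t hc (z := x - y + ε) (abs_le.2 ⟨by linarith, by linarith⟩)
  rw [ENNReal.toReal_ofReal x.coe_nonneg, ENNReal.toReal_ofReal y.coe_nonneg, ← Real.exp_add]
  have e : t * (x : ℝ) + t * (ε - y) = t * (x - y + ε) := by ring
  rw [e]
  linarith

/-- Hoeffding's estimate for one step with drift at most `-ε` and increments bounded by `ζ`. -/
theorem tsum_mul_expENN_le {ι : Type*} {t ε ζ : ℝ} (ht : 0 ≤ t) (hε : 0 < ε) (hζ : 0 ≤ ζ)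
    {p X : ι → ℝ≥0∞} {y : ℝ≥0∞} (hp : ∑' i, p i = 1)
    (hmean : ENNReal.ofReal ε + ∑' i, p i * X i ≤ y)
    (hdiff : y < ∞ → ∀ i, 0 < p i → absDiff (X i) y ≤ ENNReal.ofReal ζ) :
    ∑' i, p i * expENN t (X i) ≤
      ENNReal.ofReal (Real.exp (-(t * ε) + (t * (ε + ζ)) ^ 2 / 2)) * expENN t y := by
  by_cases hy : y = ∞
  · rw [hy, expENN_top, ENNReal.mul_top (by simp [Real.exp_pos])]
    exact le_top
  set β := Real.sinh (t * (ε + ζ)) / (ε + ζ) with hβd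
  set C := Real.cosh (t * (ε + ζ)) with hC
  have hC0 : 0 ≤ C := (Real.cosh_pos _).le
  have hβ : 0 ≤ β := div_nonneg (Real.sinh_nonneg_iff.2 (by positivity)) (by positivity)
  -- Outcomes of weight 0 are split off because the increments are controlled only on the support of
  -- p.
  have hpt : ∀ i, p i * expENN t (X i) * ENNReal.ofReal (Real.exp (t * (ε - y.toReal))) +
      p i * (y * ENNReal.ofReal β) ≤
      p i * ENNReal.ofReal (C + ε * β) + ENNReal.ofReal β * (p i * X i) := by
    intro i
    rcases eq_or_ne (p i) 0 with h0 | h0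
    · simp [h0]
    have := mul_le_mul_right (expENN_mul_add_le ht hε hζ hy
      (hdiff (lt_top_iff_ne_top.2 hy) i (pos_iff_ne_zero.2 h0))) (p i)
    calc _ = p i * (expENN t (X i) * ENNReal.ofReal (Real.exp (t * (ε - y.toReal))) +
        y * ENNReal.ofReal β) := by ring
      _ ≤ _ := this
      _ = _ := by ring
  have hsum := ENNReal.tsum_le_tsum hpt
  rw [ENNReal.tsum_add, ENNReal.tsum_add, ENNReal.tsum_mul_right, ENNReal.tsum_mul_right,
    ENNReal.tsum_mul_right, ENNReal.tsum_mul_left, hp, one_mul, one_mul,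
    ENNReal.ofReal_add hC0 (by positivity), mul_comm ε β, ENNReal.ofReal_mul hβ, add_assoc,
    ← mul_add] at hsum
  have h3 : (∑' i, p i * expENN t (X i)) * ENNReal.ofReal (Real.exp (t * (ε - y.toReal))) ≤
      ENNReal.ofReal (Real.exp ((t * (ε + ζ)) ^ 2 / 2)) := by
    refine le_trans ?_ (ENNReal.ofReal_le_ofReal (Real.cosh_le_exp_half_sq (t * (ε + ζ))))
    -- The drift condition bounds β(ε + ∑ p X) by βy, as β ≥ 0; the finite term βy then cancels,
    -- leaving only the cosh.
    refine (ENNReal.add_le_add_iff_right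
      (ENNReal.mul_ne_top hy (ENNReal.ofReal_ne_top (r := β)))).1 (hsum.trans ?_)
    rw [mul_comm y]
    gcongr
  rw [expENN_of_ne_top t hy, ← ENNReal.ofReal_mul (Real.exp_pos _).le, ← Real.exp_add]
  rw [← ENNReal.le_div_iff_mul_le (by simp [Real.exp_pos]) (by simp),
    ← ENNReal.ofReal_div_of_pos (Real.exp_pos _), ← Real.exp_sub] at h3
  refine h3.trans (le_of_eq ?_)
  congr 2
  ring

/-! ### One step of the Markov decision process -/

/-- Used with c the contribution of the untouched lower stack. Equality can fail when c = ∞. -/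
theorem absDiff_add_right_le (a b c : ℝ≥0∞) : absDiff (a + c) (b + c) ≤ absDiff a b :=
  max_le_max add_tsub_add_le_tsub_right add_tsub_add_le_tsub_right

/-- The sum of a function on stack elements over the letters of a configuration. -/
noncomputable def configSum {W : CFG} (h : StackElem W → ℝ≥0∞) (w : Config W) : ℝ≥0∞ :=
  (w.map fun c => h c.1).sum

@[simp]
theorem configSum_cons {W : CFG} (h : StackElem W → ℝ≥0∞) (c : {c : StackElem W // ¬ c.Terminal})
    (w : Config W) : configSum h (c :: w) = h c.1 + configSum h w := by
  simp [configSum]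

/-- Deleting a terminal letter does not change the sum, since h vanishes there. -/
theorem configSum_goto {W : CFG} {h : StackElem W → ℝ≥0∞} (h0 : ∀ c, c.Terminal → h c = 0)
    (f : W.Fn) (ℓ : W.Label f) (ν : Valuation (W.PVar f)) (w : Config W) :
    configSum h (goto f ℓ ν w) = h ⟨f, ℓ, ν⟩ + configSum h w := by
  unfold goto
  split_ifs with hl
  · rw [h0 ⟨f, ℓ, ν⟩ hl, zero_add]
  · simp

/-- Once the action is fixed, the sampled valuation is the only randomness and determines the
successor. -/
theorem tsum_transProb_cons_mul {W : CFG} (Υ : SamplingFn W)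
    {c : {c : StackElem W // ¬ c.Terminal}} {w : Config W} (m : Valuation W.SVar) {a : Act}
    {N : Valuation W.SVar → Config W} (hN : ∀ μ, nextConfig c w a μ = some (N μ))
    (G : State W → ℝ≥0∞) :
    ∑' s, transProb Υ (c :: w, m) a s * G s = ∑' μ, Υ.prod μ * G (N μ, μ) := by
  rw [ENNReal.tsum_prod', ENNReal.tsum_comm]
  refine tsum_congr fun μ => ?_
  rw [tsum_eq_single (N μ)]
  · simp [transProb, hN]
  · intro w' hw'
    simp [transProb, hN, hw'.symm]

theorem not_enabled_of_nextConfig_eq_none {W : CFG} {Υ : SamplingFn W}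
    {c : {c : StackElem W // ¬ c.Terminal}} {w : Config W} {m : Valuation W.SVar} {a : Act}
    (hN : ∀ μ, nextConfig c w a μ = none) : ¬ Enabled Υ (c :: w, m) a := by
  simp [Enabled, transProb, hN]

/-- Enabledness itself supplies the total mass of the product distribution, so no computation with
products is needed. -/
theorem tsum_prod_eq_one_of_enabled {W : CFG} {Υ : SamplingFn W}
    {c : {c : StackElem W // ¬ c.Terminal}} {w : Config W} {m : Valuation W.SVar} {a : Act}
    {N : Valuation W.SVar → Config W} (hN : ∀ μ, nextConfig c w a μ = some (N μ))
    (ha : Enabled Υ (c :: w, m) a) : ∑' μ, Υ.prod μ = 1 := by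
  have := tsum_transProb_cons_mul Υ m hN fun _ => 1
  simp only [mul_one] at this
  rw [← this]
  exact ha

/-- The drift and difference bounds for configurations entail the exponential estimate. -/
theorem tsum_transProb_mul_expENN_le_of_nextConfig {W : CFG} {Υ : SamplingFn W}
    {h : StackElem W → ℝ≥0∞} {ε ζ : ℝ≥0} (hε : 0 < ε) {t : ℝ} (ht : 0 ≤ t)
    {c : {c : StackElem W // ¬ c.Terminal}} {w : Config W} {m : Valuation W.SVar} {a : Act}
    (ha : Enabled Υ (c :: w, m) a) {X : Valuation W.SVar → ℝ≥0∞}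
    {N : Valuation W.SVar → Config W} (hN : ∀ μ, nextConfig c w a μ = some (N μ))
    (hX : ∀ μ, configSum h (N μ) = X μ + configSum h w)
    (hmean : ∑' μ, Υ.prod μ = 1 → ε + ∑' μ, Υ.prod μ * X μ ≤ h c.1)
    (hdiff : h c.1 < ∞ → ∀ μ, 0 < Υ.prod μ → absDiff (X μ) (h c.1) ≤ ζ) :
    ∑' s, transProb Υ (c :: w, m) a s * expENN t (configSum h s.1) ≤
      ENNReal.ofReal (Real.exp (-(t * ε) + (t * (ε + ζ)) ^ 2 / 2)) *
        expENN t (configSum h (c :: w)) := by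
  have h1 := tsum_prod_eq_one_of_enabled hN ha
  rw [tsum_transProb_cons_mul Υ m hN]
  refine tsum_mul_expENN_le ht (NNReal.coe_pos.2 hε) ζ.coe_nonneg h1 ?_ ?_
  · simp only [hX, mul_add, configSum_cons]
    rw [ENNReal.tsum_add, ENNReal.tsum_mul_right, h1, one_mul, ← add_assoc,
      ENNReal.ofReal_coe_nnreal]
    gcongr
    exact hmean h1
  · intro hfin μ hμ
    rw [configSum_cons] at hfin ⊢
    rw [hX, ENNReal.ofReal_coe_nnreal]
    exact (absDiff_add_right_le _ _ _).trans (hdiff (lt_of_le_of_lt le_self_add hfin) μ hμ)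

open Classical in
theorem tsum_transProb_mul_expENN_le {W : CFG} {Υ : SamplingFn W}
    {h : StackElem W → ℝ≥0∞} {ε ζ : ℝ≥0} (hε : 0 < ε) (hrank : IsRankingWith Υ h ε)
    (hdiff : IsDiffBoundedWith Υ h ζ) {t : ℝ} (ht : 0 ≤ t)
    (c : {c : StackElem W // ¬ c.Terminal}) (w : Config W) (m : Valuation W.SVar) (a : Act)
    (ha : Enabled Υ (c :: w, m) a) :
    ∑' s, transProb Υ (c :: w, m) a s * expENN t (configSum h s.1) ≤
      ENNReal.ofReal (Real.exp (-(t * ε) + (t * (ε + ζ)) ^ 2 / 2)) *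
        expENN t (configSum h (c :: w)) := by
  obtain ⟨⟨f, ℓ, ν⟩, hc⟩ := c
  obtain ⟨h0, hr⟩ := hrank
  specialize hr f ℓ hc ν
  have hd := hdiff f ℓ hc ν
  -- Outside assignments the successor ignores the sample, so its mean value is the value itself.
  have const : ∀ {x : ℝ≥0∞}, ε + x ≤ h ⟨f, ℓ, ν⟩ → ∑' μ, Υ.prod μ = 1 →
      ε + ∑' μ, Υ.prod μ * x ≤ h ⟨f, ℓ, ν⟩ := by
    intro x hx h1
    rwa [ENNReal.tsum_mul_right, h1, one_mul]
  cases hi : W.instr f ℓ hc with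
  | assign u ℓ' =>
    simp only [hi] at hr hd
    cases a with
    | tau =>
      exact tsum_transProb_mul_expENN_le_of_nextConfig hε ht ha
        (N := fun μ => goto f ℓ' (u ν μ) w) (fun μ => by simp [nextConfig, hi])
        (fun μ => configSum_goto h0 f ℓ' (u ν μ) w) (fun _ => hr) hd
    | th => exact absurd ha (not_enabled_of_nextConfig_eq_none fun μ => by simp [nextConfig, hi])
    | el => exact absurd ha (not_enabled_of_nextConfig_eq_none fun μ => by simp [nextConfig, hi])
  | call g v ℓ' =>
    simp only [hi] at hr hd
    cases a with
    | tau =>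
      exact tsum_transProb_mul_expENN_le_of_nextConfig hε ht ha
        (N := fun μ => ⟨⟨g, W.lin g, v ν⟩, W.lin_ne_lout g⟩ :: goto f ℓ' ν w)
        (X := fun _ => h ⟨g, W.lin g, v ν⟩ + h ⟨f, ℓ', ν⟩)
        (fun μ => by simp [nextConfig, hi])
        (fun μ => by rw [configSum_cons, configSum_goto h0, add_assoc])
        (const (by rwa [← add_assoc])) (fun hf μ _ => hd hf)
    | th => exact absurd ha (not_enabled_of_nextConfig_eq_none fun μ => by simp [nextConfig, hi])
    | el => exact absurd ha (not_enabled_of_nextConfig_eq_none fun μ => by simp [nextConfig, hi])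
  | branch φ ℓ₁ ℓ₂ =>
    simp only [hi] at hr hd
    have e : (if φ.Sat ν then h ⟨f, ℓ₁, ν⟩ else 0) + (if φ.not.Sat ν then h ⟨f, ℓ₂, ν⟩ else 0) =
        h ⟨f, if φ.Sat ν then ℓ₁ else ℓ₂, ν⟩ := by
      by_cases hφ : φ.Sat ν <;> simp [ArithPred.Sat, hφ]
    rw [e] at hr hd
    cases a with
    | tau =>
      exact tsum_transProb_mul_expENN_le_of_nextConfig hε ht ha
        (N := fun _ => goto f (if φ.Sat ν then ℓ₁ else ℓ₂) ν w)
        (fun μ => by simp [nextConfig, hi])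
        (fun μ => configSum_goto h0 f _ ν w) (const (by rwa [add_comm])) (fun hf μ _ => hd hf)
    | th => exact absurd ha (not_enabled_of_nextConfig_eq_none fun μ => by simp [nextConfig, hi])
    | el => exact absurd ha (not_enabled_of_nextConfig_eq_none fun μ => by simp [nextConfig, hi])
  | nondet ℓ₁ ℓ₂ =>
    simp only [hi] at hr hd
    rw [add_comm] at hr
    cases a with
    | tau => exact absurd ha (not_enabled_of_nextConfig_eq_none fun μ => by simp [nextConfig, hi])
    | th =>
      exact tsum_transProb_mul_expENN_le_of_nextConfig hε ht ha
        (N := fun _ => goto f ℓ₁ ν w) (fun μ => by simp [nextConfig, hi])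
        (fun μ => configSum_goto h0 f ℓ₁ ν w)
        (const (le_trans (by gcongr; exact le_max_left _ _) hr))
        (fun hf μ _ => (le_max_left _ _).trans (hd hf))
    | el =>
      exact tsum_transProb_mul_expENN_le_of_nextConfig hε ht ha
        (N := fun _ => goto f ℓ₂ ν w) (fun μ => by simp [nextConfig, hi])
        (fun μ => configSum_goto h0 f ℓ₂ ν w)
        (const (le_trans (by gcongr; exact le_max_right _ _) hr))
        (fun hf μ _ => (le_max_right _ _).trans (hd hf))

/-- The exponential potential of a state, which vanishes after termination. -/
noncomputable def potential {W : CFG} (h : StackElem W → ℝ≥0∞) (t : ℝ) : State W → ℝ≥0∞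
  | ([], _) => 0
  | (c :: w, _) => expENN t (configSum h (c :: w))

theorem potential_le {W : CFG} (h : StackElem W → ℝ≥0∞) (t : ℝ) (s : State W) :
    potential h t s ≤ expENN t (configSum h s.1) := by
  obtain ⟨_ | ⟨c, w⟩, m⟩ := s
  · exact bot_le
  · exact le_rfl

theorem one_le_potential {W : CFG} (h : StackElem W → ℝ≥0∞) {t : ℝ} (ht : 0 ≤ t) {s : State W}
    (hs : s.1 ≠ []) : 1 ≤ potential h t s := by
  obtain ⟨_ | ⟨c, w⟩, m⟩ := s
  · exact absurd rfl hs
  · exact one_le_expENN ht _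

theorem tsum_transProb_mul_potential_le {W : CFG} {Υ : SamplingFn W}
    {h : StackElem W → ℝ≥0∞} {ε ζ : ℝ≥0} (hε : 0 < ε) (hrank : IsRankingWith Υ h ε)
    (hdiff : IsDiffBoundedWith Υ h ζ) {t : ℝ} (ht : 0 ≤ t) (s : State W) (a : Act)
    (ha : Enabled Υ s a) :
    ∑' s', transProb Υ s a s' * potential h t s' ≤
      ENNReal.ofReal (Real.exp (-(t * ε) + (t * (ε + ζ)) ^ 2 / 2)) * potential h t s := by
  obtain ⟨_ | ⟨c, w⟩, m⟩ := s
  -- The empty stack is absorbing: each successor is either empty, with potential 0, or has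
  -- probability 0.
  · refine le_of_eq_of_le (ENNReal.tsum_eq_zero.2 fun s' => ?_) bot_le
    obtain ⟨_ | ⟨c, w⟩, m'⟩ := s'
    · simp [potential]
    · simp [transProb]
  · exact (ENNReal.tsum_le_tsum fun s' => mul_le_mul_right (potential_le h t s') _).trans
      (tsum_transProb_mul_expENN_le hε hrank hdiff ht c w m a ha)

/-! ### The induced Markov chain -/

/-- Restricting to the support, which is always countable, removes any countability assumption on
the type. -/
theorem lintegral_toMeasure_eq_tsum {α : Type*} [MeasurableSpace α] [MeasurableSingletonClass α]
    (p : PMF α) (g : α → ℝ≥0∞) : ∫⁻ a, g a ∂p.toMeasure = ∑' a, p a * g a := by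
  rw [← PMF.restrict_toMeasure_support, lintegral_countable _ p.support_countable]
  simp_rw [PMF.toMeasure_apply_singleton p _ (measurableSet_singleton _), mul_comm (g _)]
  exact tsum_subtype_eq_of_support_subset (f := fun a => p a * g a)
    fun x hx => (PMF.mem_support_iff p x).2 (left_ne_zero_of_mul hx)

theorem tsum_bind_mul {α β : Type*} (p : PMF α) (f : α → PMF β) (G : β → ℝ≥0∞) :
    ∑' b, p.bind f b * G b = ∑' a, p a * ∑' b, f a b * G b := by
  simp_rw [PMF.bind_apply, ← ENNReal.tsum_mul_right, ← ENNReal.tsum_mul_left]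
  rw [ENNReal.tsum_comm]
  exact tsum_congr fun a => tsum_congr fun b => mul_assoc _ _ _

theorem History.last_snoc {W : CFG} {Υ : SamplingFn W} (ρ : History Υ) (s : State W)
    (h : ∃ a, 0 < transProb Υ ρ.last a s) : (ρ.snoc s h).last = s := by
  simp [History.last, History.snoc]

/-- Each possible next state comes from exactly one extension of the history, so the chain on
histories reduces to one step of the decision process. -/
theorem lintegral_stepKernel_last {W : CFG} {Υ : SamplingFn W} (σ : Scheduler Υ) (ρ : History Υ)
    (G : State W → ℝ≥0∞) :
    ∫⁻ ρ', G ρ'.last ∂(stepKernel σ ρ) = ∑' s, nextState σ ρ s * G s := by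
  change ∫⁻ ρ', G ρ'.last ∂(nextHistory σ ρ).toMeasure = _
  rw [lintegral_toMeasure_eq_tsum]
  simp_rw [nextHistory, PMF.bindOnSupport_apply, ← ENNReal.tsum_mul_right]
  rw [ENNReal.tsum_comm]
  refine tsum_congr fun s => ?_
  by_cases hs : nextState σ ρ s = 0
  · simp [hs]
  · have hp := exists_transProb_pos σ ρ s ((PMF.mem_support_iff _ _).2 hs)
    rw [tsum_eq_single (ρ.snoc s hp)]
    · simp [hs, History.last_snoc]
    · intro ρ' hρ'
      simp [hs, hρ']

/-- The scheduler drops out here: the bound has the same constant for every enabled action, hence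
survives averaging over actions. -/
theorem lintegral_stepKernel_potential_le {W : CFG} {Υ : SamplingFn W}
    {h : StackElem W → ℝ≥0∞} {ε ζ : ℝ≥0} (hε : 0 < ε) (hrank : IsRankingWith Υ h ε)
    (hdiff : IsDiffBoundedWith Υ h ζ) {t : ℝ} (ht : 0 ≤ t) (σ : Scheduler Υ) (ρ : History Υ) :
    ∫⁻ ρ', potential h t ρ'.last ∂(stepKernel σ ρ) ≤
      ENNReal.ofReal (Real.exp (-(t * ε) + (t * (ε + ζ)) ^ 2 / 2)) * potential h t ρ.last := by
  rw [lintegral_stepKernel_last]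
  refine (tsum_bind_mul (σ ρ) _ _).trans_le ?_
  refine (ENNReal.tsum_le_tsum fun a : {a : Act // Enabled Υ ρ.last a} => mul_le_mul_right
    (tsum_transProb_mul_potential_le hε hrank hdiff ht ρ.last a.1 a.2) _).trans ?_
  rw [ENNReal.tsum_mul_right, PMF.tsum_coe, one_mul]

theorem map_eval_zero_runMeasure {W : CFG} {Υ : SamplingFn W} (σ : Scheduler Υ) (c : StackElem W)
    (hc : ¬ c.Terminal) :
    (runMeasure σ c hc).map (fun ω => ω 0) =
      Measure.dirac (History.single Υ ([⟨c, hc⟩], 0)) := by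
  have e : (fun ω : ℕ → History Υ => ω 0) =
      (fun x : (i : Finset.Iic 0) → History Υ => x ⟨0, Finset.mem_Iic.2 le_rfl⟩) ∘
        Preorder.frestrictLe 0 := rfl
  rw [e, ← Measure.map_map (by fun_prop) (by fun_prop), runMeasure, Kernel.trajMeasure,
    Measure.map_comp _ _ (by fun_prop), Kernel.traj_map_frestrictLe, Kernel.partialTraj_self,
    Measure.id_comp, Measure.map_map (by fun_prop) (by fun_prop), Measure.map_dirac' (by fun_prop)]
  rfl

/-- The Markov property: given the path up to time n, the next coordinate is drawn from a kernel
that sees only coordinate n. -/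
theorem lintegral_runMeasure_succ {W : CFG} {Υ : SamplingFn W} (σ : Scheduler Υ) (c : StackElem W)
    (hc : ¬ c.Terminal) (n : ℕ) (g : History Υ → ℝ≥0∞) :
    ∫⁻ ω, g (ω (n + 1)) ∂(runMeasure σ c hc) =
      ∫⁻ ω, ∫⁻ ρ, g ρ ∂(stepKernel σ (ω n)) ∂(runMeasure σ c hc) := by
  have hg : Measurable g := Measurable.of_discrete
  have key := Kernel.map_frestrictLe_trajMeasure_compProd_eq_map_trajMeasure
    (X := fun _ => History Υ)
    (μ₀ := Measure.dirac (History.single Υ ([⟨c, hc⟩], 0)))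
    (κ := fun n => (stepKernel σ).comap
      (fun ω : (i : Finset.Iic n) → History Υ => ω ⟨n, Finset.mem_Iic.2 le_rfl⟩)
      (measurable_pi_apply _)) (a := n)
  have key2 := congrArg (fun m => ∫⁻ x, g x.2 ∂m) key
  rw [Measure.lintegral_compProd (by fun_prop), lintegral_map (by fun_prop) (by fun_prop),
    lintegral_map (by fun_prop) (by fun_prop)] at key2
  exact key2.symm

theorem lintegral_runMeasure_potential_le {W : CFG} {Υ : SamplingFn W}
    {h : StackElem W → ℝ≥0∞} {ε ζ : ℝ≥0} (hε : 0 < ε) (hrank : IsRankingWith Υ h ε)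
    (hdiff : IsDiffBoundedWith Υ h ζ) {t : ℝ} (ht : 0 ≤ t) (σ : Scheduler Υ) (c : StackElem W)
    (hc : ¬ c.Terminal) (n : ℕ) :
    ∫⁻ ω, potential h t (ω n).last ∂(runMeasure σ c hc) ≤
      ENNReal.ofReal (Real.exp (-(t * ε) + (t * (ε + ζ)) ^ 2 / 2)) ^ n * expENN t (h c) := by
  induction n with
  | zero =>
    have hm : Measurable fun ρ : History Υ => potential h t ρ.last := Measurable.of_discrete
    have hmap := lintegral_map (μ := runMeasure σ c hc) hm (measurable_pi_apply 0)
    rw [map_eval_zero_runMeasure, lintegral_dirac] at hmap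
    rw [← hmap]
    simp [History.last, History.single, potential, configSum]
  | succ n ih =>
    have hm : Measurable fun ρ : History Υ => potential h t ρ.last := Measurable.of_discrete
    set κ := ENNReal.ofReal (Real.exp (-(t * ε) + (t * (ε + ζ)) ^ 2 / 2))
    calc ∫⁻ ω, potential h t (ω (n + 1)).last ∂(runMeasure σ c hc)
        = ∫⁻ ω, ∫⁻ ρ, potential h t ρ.last ∂(stepKernel σ (ω n)) ∂(runMeasure σ c hc) :=
          lintegral_runMeasure_succ σ c hc n fun ρ => potential h t ρ.last
      _ ≤ ∫⁻ ω, κ * potential h t (ω n).last ∂(runMeasure σ c hc) :=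
          lintegral_mono fun ω => lintegral_stepKernel_potential_le hε hrank hdiff ht σ (ω n)
      _ = κ * ∫⁻ ω, potential h t (ω n).last ∂(runMeasure σ c hc) :=
          lintegral_const_mul κ (hm.comp (measurable_pi_apply n))
      _ ≤ κ * (κ ^ n * expENN t (h c)) := by gcongr
      _ = κ ^ (n + 1) * expENN t (h c) := by rw [pow_succ', mul_assoc]

theorem ne_nil_of_lt_terminationTime {W : CFG} {Υ : SamplingFn W} {ω : ℕ → History Υ} {n : ℕ}
    (hn : (n : ℕ∞) < terminationTime ω) : (ω n).last.1 ≠ [] :=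
  fun h0 => not_le_of_gt hn (iInf₂_le n h0)

theorem runMeasure_lt_terminationTime_le {W : CFG} {Υ : SamplingFn W}
    {h : StackElem W → ℝ≥0∞} {ε ζ : ℝ≥0} (hε : 0 < ε) (hrank : IsRankingWith Υ h ε)
    (hdiff : IsDiffBoundedWith Υ h ζ) {t : ℝ} (ht : 0 ≤ t) (σ : Scheduler Υ) (c : StackElem W)
    (hc : ¬ c.Terminal) (n : ℕ) :
    runMeasure σ c hc {ω | (n : ℕ∞) < terminationTime ω} ≤
      ENNReal.ofReal (Real.exp (-(t * ε) + (t * (ε + ζ)) ^ 2 / 2)) ^ n * expENN t (h c) := by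
  have hm : Measurable fun ρ : History Υ => potential h t ρ.last := Measurable.of_discrete
  calc runMeasure σ c hc {ω | (n : ℕ∞) < terminationTime ω}
      ≤ runMeasure σ c hc {ω | 1 ≤ potential h t (ω n).last} :=
        -- Monotonicity needs no measurability of the termination time; Markov's inequality is
        -- applied to the larger event.
        measure_mono fun ω hω => one_le_potential h ht (ne_nil_of_lt_terminationTime hω)
    _ ≤ ∫⁻ ω, potential h t (ω n).last ∂(runMeasure σ c hc) := by
        simpa using mul_meas_ge_le_lintegral (μ := runMeasure σ c hc)
          (hm.comp (measurable_pi_apply n)) 1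
    _ ≤ _ := lintegral_runMeasure_potential_le hε hrank hdiff ht σ c hc n

end RecProg

theorem mainTheorem10 (W : RecProg.CFG) (Υ : RecProg.SamplingFn W)
    (h : RecProg.StackElem W → ℝ≥0∞) (ε ζ : ℝ≥0) (hε : 0 < ε) (hζ : 0 < ζ)
    (hrank : RecProg.IsRankingWith Υ h ε) (hdiff : RecProg.IsDiffBoundedWith Υ h ζ)
    (c : RecProg.StackElem W) (hc : ¬ c.Terminal) (hfin : h c < ∞)
    (n : ℕ) (hn : (h c).toReal / (ε : ℝ) < (n : ℝ)) :
    (⨆ σ : RecProg.Scheduler Υ,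
        RecProg.runMeasure σ c hc {ω | (n : ℕ∞) < RecProg.terminationTime ω}) ≤
      ENNReal.ofReal (Real.exp
        (-(((ε : ℝ) * n - (h c).toReal) ^ 2 / (2 * n * ((ε : ℝ) + ζ) ^ 2)))) := by
  have hε' : (0 : ℝ) < ε := NNReal.coe_pos.2 hε
  have hn0 : (0 : ℝ) < n := lt_of_le_of_lt (by positivity) hn
  have hlt : (h c).toReal < ε * n := by rwa [div_lt_iff₀' hε'] at hn
  refine iSup_le fun σ => ?_
  -- With a = εn - h(c) > 0 and s = ε + ζ the exponent is -ta + n s² t²/2. Its minimiser t = a/(n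
  -- s²) gives -a²/(2 n s²).
  refine (RecProg.runMeasure_lt_terminationTime_le hε hrank hdiff
    (t := ((ε : ℝ) * n - (h c).toReal) / (n * ((ε : ℝ) + ζ) ^ 2))
    (div_nonneg (by linarith) (by positivity)) σ c hc n).trans (le_of_eq ?_)
  rw [RecProg.expENN_of_ne_top _ hfin.ne, ← ENNReal.ofReal_pow (Real.exp_pos _).le,
    ← ENNReal.ofReal_mul (by positivity), ← Real.exp_nat_mul, ← Real.exp_add]
  congr 2
  field_simp
  ring
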